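/- Let $OH=(\mathcal V,\mathcal E,w)$ be a weighted oriented hypergraph: $\mathcal V=\{1,\dots,N\}$, $\mathcal E$ is a set of pairs $e=(e_{\mathrm{in}},e_{\mathrm{out}})$ of disjoint subsets of $\mathcal V$, and $w:\mathcal E\to\mathbb R_{\ge 0}$. For $e=(e_{\mathrm{in}},e_{\mathrm{out}})$ the opposite hyperedge is $\tilde e=(e_{\mathrm{out}},e_{\mathrm{in}})$; the weights are called symmetric if $w(\tilde e)=w(e)$ whenever $e,\tilde e\in\mathcal E$. Let $\mathcal M$ be a connected, complete Riemannian manifold with induced distance $d$. For $x,y\in\mathcal M$ we say that $\log_x y$ exists if there is exactly one length-minimizing geodesic segment $\gamma_{xy}:[0,1]\to\mathcal M$ from $x$ to $y$, that is, exactly one $v\in T_x\mathcal M$ with $\exp_x v=y$ and $\|v\|=d(x,y)$; then $\log_x y:=v$, and $\mathrm{PT}_{x\to y}:T_x\mathcal M\to T_y\mathcal M$ denotes parallel transport along $\gamma_{xy}$. Let $f:\mathcal V\to\mathcal M$ be such that for every $e\in\mathcal E$ the Fréchet means $x_{\mathrm{in}}(e)=\operatorname{argmin}_{x\in\mathcal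 M}\sum_{u\in e_{\mathrm{in}}}d(x,f(u))^2$ and $x_{\mathrm{out}}(e)=\operatorname{argmin}_{x\in\mathcal M}\sum_{v\in e_{\mathrm{out}}}d(x,f(v))^2$ exist and are unique, and $\log_{f(u)}f(v)$ exists for all $u\in e_{\mathrm{in}}$, $v\in e_{\mathrm{out}}$. The Fréchet gradient and the pairwise gradient of $f$ are $$\nabla^F f(e)=\sqrt{w(e)}\,\log_{x_{\mathrm{in}}}x_{\mathrm{out}}\in T_{x_{\mathrm{in}}}\mathcal M,\qquad \nabla^P f(e)(u,v)=\frac{\sqrt{w(e)}}{|e_{\mathrm{in}}|\,|e_{\mathrm{out}}|}\log_{f(u)}f(v)\in T_{f(u)}\mathcal M$$ for $u\in e_{\mathrm{in}}$, $v\in e_{\mathrm{out}}$, with $\nabla^P f(e)(u,v)=0$ for all other $(u,v)\in\mathcal V\times\mathcal V$. Then: (i) If $e\in\mathcal E$ and $f(u)=f(v)$ for all $u\in e_{\mathrm{in}}$, $v\in e_{\mathrm{out}}$, then $\log_{x_{\mathrm{in}}}x_{\mathrm{out}}$ exists and $\nabla^F f(e)=0$. (ii) If the weights are symmetric, $e,\tilde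 e\in\mathcal E$ and $\log_{x_{\mathrm{in}}}x_{\mathrm{out}}$ exists (where $x_{\mathrm{in}},x_{\mathrm{out}}$ are the means for $e$), then $\nabla^F f(e)=-\mathrm{PT}_{x_{\mathrm{out}}\to x_{\mathrm{in}}}\nabla^F f(\tilde e)$. (iii) Let $e\in\mathcal E$. If $f(u)=f(v)$ for all $u\in e_{\mathrm{in}}$, $v\in e_{\mathrm{out}}$, then $\nabla^P f(e)=0$. If $w(e)>0$, then $\nabla^P f(e)=0$ if and only if $f(u)=f(v)$ for all $u\in e_{\mathrm{in}}$, $v\in e_{\mathrm{out}}$. (iv) If the weights are symmetric and $e,\tilde e\in\mathcal E$, then $\nabla^P f(e)(u,v)=-\mathrm{PT}_{f(v)\to f(u)}\nabla^P f(\tilde e)(v,u)$ for all $u\in e_{\mathrm{in}}$, $v\in e_{\mathrm{out}}$. -/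

import Mathlib

open Bundle
open scoped Manifold ContDiff NNReal

/-! ### Oriented hypergraphs -/

/-- A weighted oriented hypergraph on the vertices `Fin N`. A hyperedge is a pair
`e = (e_in, e_out)` of disjoint vertex sets, carrying a weight `w(e) ≥ 0`. -/
structure OrientedHypergraph (N : ℕ) where
  edges : Set (Finset (Fin N) × Finset (Fin N))
  weight : edges → ℝ≥0
  disjoint_in_out : ∀ e ∈ edges, Disjoint e.1 e.2

/-- The oriented hyperedge `(e_out, e_in)` opposite to `e = (e_in, e_out)`. -/
def oppositeEdge {N : ℕ} (e : Finset (Fin N) × Finset (Fin N)) :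
    Finset (Fin N) × Finset (Fin N) :=
  (e.2, e.1)

/-- The edge weights are symmetric: a hyperedge and its opposite, when both are hyperedges,
have the same weight. (In a symmetric hypergraph the opposite of a hyperedge always is one.) -/
def OrientedHypergraph.HasSymmetricWeights {N : ℕ} (OH : OrientedHypergraph N) : Prop :=
  ∀ (e : Finset (Fin N) × Finset (Fin N)) (he : e ∈ OH.edges)
    (he' : oppositeEdge e ∈ OH.edges), OH.weight ⟨oppositeEdge e, he'⟩ = OH.weight ⟨e, he⟩

/-! ### Levi-Civita connection, geodesics, exponential map, logarithm, parallel transport -/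

noncomputable section Riemannian

variable {n : ℕ} {M : Type*} [MetricSpace M] [ChartedSpace (EuclideanSpace ℝ (Fin n)) M]
  [RiemannianBundle (fun x : M => TangentSpace (𝓡 n) x)]

/-- The Gram matrix `g_ij(z) = ⟨∂_i, ∂_j⟩` of the Riemannian metric in the chart around `x₀`,
as a function of the coordinates `z`. -/
def metricMatrix (x₀ : M) (z : EuclideanSpace ℝ (Fin n)) : Matrix (Fin n) (Fin n) ℝ :=
  Matrix.of fun i j =>
    inner ℝ
      (mfderiv 𝓘(ℝ, EuclideanSpace ℝ (Fin n)) (𝓡 n) (extChartAt (𝓡 n) x₀).symm z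
        (EuclideanSpace.single i (1 : ℝ)) : TangentSpace (𝓡 n) ((extChartAt (𝓡 n) x₀).symm z))
      (mfderiv 𝓘(ℝ, EuclideanSpace ℝ (Fin n)) (𝓡 n) (extChartAt (𝓡 n) x₀).symm z
        (EuclideanSpace.single j (1 : ℝ)) : TangentSpace (𝓡 n) ((extChartAt (𝓡 n) x₀).symm z))

/-- The partial derivative `∂_i g_jl` of the metric coefficients in the chart around `x₀`. -/
def metricPartial (x₀ : M) (z : EuclideanSpace ℝ (Fin n)) (i j l : Fin n) : ℝ :=
  fderiv ℝ (fun z' => metricMatrix x₀ z' j l) z (EuclideanSpace.single i (1 : ℝ))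

/-- The Christoffel symbols of the Levi-Civita connection in the chart around `x₀`,
`Γ^k_ij = ½ ∑_l g^{kl} (∂_i g_jl + ∂_j g_il - ∂_l g_ij)`. -/
def christoffel (x₀ : M) (z : EuclideanSpace ℝ (Fin n)) (k i j : Fin n) : ℝ :=
  (1 / 2 : ℝ) * ∑ l, (metricMatrix x₀ z)⁻¹ k l *
    (metricPartial x₀ z i j l + metricPartial x₀ z j i l - metricPartial x₀ z l i j)

/-- The coordinates, in the chart around `x₀`, of a tangent vector `X` at `p`. -/
def tangentCoord (x₀ p : M) (X : TangentSpace (𝓡 n) p) : EuclideanSpace ℝ (Fin n) :=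
  mfderiv (𝓡 n) 𝓘(ℝ, EuclideanSpace ℝ (Fin n)) (extChartAt (𝓡 n) x₀) p X

/-- The `k`-th component, in the chart around `x₀`, of the covariant derivative `D_t V` at time
`t` of a vector field `V` along the curve `γ`:
`(V^k)' + ∑_ij Γ^k_ij(γ) (γ^i)' V^j`. -/
def covDerivCoord (x₀ : M) (γ : ℝ → M) (V : (t : ℝ) → TangentSpace (𝓡 n) (γ t)) (t : ℝ)
    (k : Fin n) : ℝ :=
  deriv (fun s => tangentCoord x₀ (γ s) (V s) k) t +
    ∑ i, ∑ j, christoffel x₀ (extChartAt (𝓡 n) x₀ (γ t)) k i j *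
      deriv (fun s => extChartAt (𝓡 n) x₀ (γ s) i) t * tangentCoord x₀ (γ t) (V t) j

variable [IsManifold (𝓡 n) ∞ M]

/-- `V` is a smooth vector field along the curve `γ` which is parallel for the Levi-Civita
connection: `D_t V = 0` at all times (expressed in all the charts around the point). -/
def IsParallelAlong (γ : ℝ → M) (V : (t : ℝ) → TangentSpace (𝓡 n) (γ t)) : Prop :=
  ContMDiff 𝓘(ℝ, ℝ) (𝓡 n).tangent ∞ (fun t => (⟨γ t, V t⟩ : TangentBundle (𝓡 n) M)) ∧
  ∀ (t : ℝ) (x₀ : M), γ t ∈ (extChartAt (𝓡 n) x₀).source →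
    ∀ k, covDerivCoord x₀ γ V t k = 0

/-- The velocity `γ'(t)`. -/
def velocity (γ : ℝ → M) (t : ℝ) : TangentSpace (𝓡 n) (γ t) :=
  mfderiv 𝓘(ℝ, ℝ) (𝓡 n) γ t (1 : ℝ)

variable (n) in
/-- A geodesic, defined for all times: a smooth curve with `D_t γ' = 0`. -/
def IsGeodesic (γ : ℝ → M) : Prop :=
  ContMDiff 𝓘(ℝ, ℝ) (𝓡 n) ∞ γ ∧ IsParallelAlong (n := n) γ (velocity γ)

/-- `γ` is a geodesic with `γ(0) = x`, `γ'(0) = v` and `γ(1) = y`. -/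
def IsGeodesicSegment (γ : ℝ → M) (x : M) (v : TangentSpace (𝓡 n) x) (y : M) : Prop :=
  IsGeodesic n γ ∧ (⟨γ 0, velocity γ 0⟩ : TangentBundle (𝓡 n) M) = ⟨x, v⟩ ∧ γ 1 = y

/-- The graph of the Riemannian exponential map: `exp_x v = y`, i.e. the geodesic starting
at `x` with velocity `v` is at `y` at time `1`. -/
def ExpEq (x : M) (v : TangentSpace (𝓡 n) x) (y : M) : Prop :=
  ∃ γ : ℝ → M, IsGeodesicSegment γ x v y

/-- `v` is the initial velocity of a length-minimizing geodesic segment from `x` to `y`: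
`exp_x v = y`, and the length `‖v‖` of the segment `t ↦ exp_x (t v)`, `0 ≤ t ≤ 1`, is the
distance of `x` and `y`. -/
def IsMinimizingVelocity (x y : M) (v : TangentSpace (𝓡 n) x) : Prop :=
  ExpEq x v y ∧ ‖v‖ = dist x y

variable (n) in
/-- `log_x y` exists: there is exactly one length-minimizing geodesic segment from `x` to `y`.
This holds in particular for all `y` in the image under `exp_x` of its injectivity domain. -/
def LogExists (x y : M) : Prop :=
  ∃! v : TangentSpace (𝓡 n) x, IsMinimizingVelocity x y v

variable (n) in
/-- The Riemannian logarithm `log_x y`: the shortest `v` with `exp_x v = y`, meaningful where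
`LogExists` holds. -/
def riemannianLog (x y : M) : TangentSpace (𝓡 n) x :=
  Classical.epsilon fun v => IsMinimizingVelocity x y v

variable (n) in
/-- The length-minimizing geodesic `γ_xy` with `γ_xy(0) = x`, `γ_xy(1) = y`, meaningful where
`LogExists` holds. -/
def minGeodesic (x y : M) : ℝ → M :=
  @Classical.epsilon (ℝ → M) ⟨fun _ => x⟩
    fun γ => IsGeodesicSegment γ x (riemannianLog n x y) y

/-- The parallel transport `PT_{x → y} X` along `γ_xy`: the value `V(1)` of the parallel vector
field `V` along `γ_xy` with `V(0) = X`. -/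
def parallelTransport (x y : M) (X : TangentSpace (𝓡 n) x) : TangentSpace (𝓡 n) y :=
  Classical.epsilon fun Y =>
    ∃ V : (t : ℝ) → TangentSpace (𝓡 n) (minGeodesic n x y t),
      IsParallelAlong (minGeodesic n x y) V ∧
      (⟨minGeodesic n x y 0, V 0⟩ : TangentBundle (𝓡 n) M) = ⟨x, X⟩ ∧
      (⟨minGeodesic n x y 1, V 1⟩ : TangentBundle (𝓡 n) M) = ⟨y, Y⟩

end Riemannian

/-! ### Fréchet means and gradients -/

noncomputable section Gradients

variable {N : ℕ} {M : Type*} [MetricSpace M]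

/-- `m` is a Fréchet mean of the points `f(u)`, `u ∈ s`: a minimizer of
`x ↦ ∑ u ∈ s, d(x, f(u))²`. -/
def IsFrechetMean (f : Fin N → M) (s : Finset (Fin N)) (m : M) : Prop :=
  ∀ x : M, ∑ u ∈ s, dist m (f u) ^ 2 ≤ ∑ u ∈ s, dist x (f u) ^ 2

/-- The Fréchet mean of the points `f(u)`, `u ∈ s`, meaningful where it exists and is unique. -/
def frechetMean [Nonempty M] (f : Fin N → M) (s : Finset (Fin N)) : M :=
  Classical.epsilon fun m => IsFrechetMean f s m

variable (n : ℕ) [ChartedSpace (EuclideanSpace ℝ (Fin n)) M] [IsManifold (𝓡 n) ∞ M]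
  [RiemannianBundle (fun x : M => TangentSpace (𝓡 n) x)]

/-- The standing assumption on vertex functions: for each hyperedge, the Fréchet means of the
in-set and of the out-set exist and are unique, and `log_{f(u)} f(v)` exists for all
`u ∈ e_in` and `v ∈ e_out`. -/
def IsAdmissible (OH : OrientedHypergraph N) (f : Fin N → M) : Prop :=
  ∀ e ∈ OH.edges, (∃! m, IsFrechetMean f e.1 m) ∧ (∃! m, IsFrechetMean f e.2 m) ∧
    ∀ u ∈ e.1, ∀ v ∈ e.2, LogExists n (f u) (f v)

/-- The Fréchet gradient `∇^F f(e) = √w(e) log_{x_in} x_out`. -/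
def frechetGradient [Nonempty M] (OH : OrientedHypergraph N) (f : Fin N → M) (e : OH.edges) :
    TangentSpace (𝓡 n) (frechetMean f e.1.1) :=
  √(OH.weight e : ℝ) • riemannianLog n (frechetMean f e.1.1) (frechetMean f e.1.2)

/-- The pairwise gradient, with components `∇^P f(e)(u, v) = √w(e) / (|e_in| |e_out|) log_{f(u)} f(v)`
for `u ∈ e_in`, `v ∈ e_out`; the components at all the other pairs, where the logarithm need
not exist, are zero. -/
def pairwiseGradient (OH : OrientedHypergraph N) (f : Fin N → M) (e : OH.edges)
    (u v : Fin N) : TangentSpace (𝓡 n) (f u) :=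
  if u ∈ e.1.1 ∧ v ∈ e.1.2 then
    (√(OH.weight e : ℝ) / ((e.1.1.card : ℝ) * (e.1.2.card : ℝ))) • riemannianLog n (f u) (f v)
  else 0

end Gradients

/-! ### Tangent vectors and the metric in coordinates -/

section Coordinates

variable {n : ℕ} {M : Type*} [MetricSpace M] [ChartedSpace (EuclideanSpace ℝ (Fin n)) M]

/-! All four claims come down to two facts about logarithms: `log_x y = 0` exactly when `x = y`,
because its norm is the distance (`LogExists.riemannianLog_eq_zero_iff`), and `PT_{y→x} log_y x =
-log_x y` (`LogExists.parallelTransport_smul_riemannianLog`).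

For the second, take a minimizing geodesic from `y` to `x`. Its velocity is parallel along it, so
transport carries the initial velocity to the final one. Run backwards, it is a geodesic from `x`
whose initial velocity is minus that final velocity; since speed is constant it is again minimizing,
and uniqueness at `x` identifies this velocity with `log_x y`.

Constant speed and uniqueness of parallel fields both follow from the constancy of `⟨V, W⟩` for
parallel `V`, `W` (`IsParallelAlong.hasDerivAt_inner`), which is metric compatibility of the
Christoffel symbols in a chart. No existence theorem for ODEs is needed: the only fields transported
are multiples of velocities. -/

lemma metricMatrix_symm [RiemannianBundle (fun x : M => TangentSpace (𝓡 n) x)]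
    {x₀ : M} (z : EuclideanSpace ℝ (Fin n)) (i j : Fin n) :
    metricMatrix x₀ z i j = metricMatrix x₀ z j i := by
  simp only [metricMatrix, Matrix.of_apply]
  exact real_inner_comm _ _

lemma metricPartial_symm [RiemannianBundle (fun x : M => TangentSpace (𝓡 n) x)]
    (x₀ : M) (z : EuclideanSpace ℝ (Fin n)) (i j l : Fin n) :
    metricPartial x₀ z i j l = metricPartial x₀ z i l j := by
  simp only [metricPartial]
  congr 2
  funext z'
  exact metricMatrix_symm z' j l

variable [IsManifold (𝓡 n) ∞ M]

lemma continuousLinearMapAt_apply_eq_tangentCoord {x₀ p : M}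
    (hp : p ∈ (chartAt (EuclideanSpace ℝ (Fin n)) x₀).source) (X : TangentSpace (𝓡 n) p) :
    (trivializationAt (EuclideanSpace ℝ (Fin n)) (TangentSpace (𝓡 n)) x₀).continuousLinearMapAt ℝ p
      X = tangentCoord x₀ p X := by
  have : IsManifold (𝓡 n) 1 M := IsManifold.of_le (n := ∞) (by simp)
  rw [TangentBundle.continuousLinearMapAt_trivializationAt hp]
  rfl

lemma trivializationAt_snd_eq_tangentCoord {x₀ p : M}
    (hp : p ∈ (chartAt (EuclideanSpace ℝ (Fin n)) x₀).source) (X : TangentSpace (𝓡 n) p) :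
    ((trivializationAt (EuclideanSpace ℝ (Fin n)) (TangentSpace (𝓡 n)) x₀)
      (⟨p, X⟩ : TangentBundle (𝓡 n) M)).2 = tangentCoord x₀ p X := by
  rw [← continuousLinearMapAt_apply_eq_tangentCoord hp,
    Trivialization.continuousLinearMapAt_apply, Trivialization.linearMapAt_apply, if_pos]
  simpa using hp

/-- This makes the coordinate functions in `covDerivCoord` genuinely differentiable, so that their
`deriv` is not a default value. -/
lemma contMDiffAt_tangentBundle_iff {γ : ℝ → M} {V : (t : ℝ) → TangentSpace (𝓡 n) (γ t)}
    {t₀ : ℝ} {x₀ : M} (h : γ t₀ ∈ (chartAt (EuclideanSpace ℝ (Fin n)) x₀).source) :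
    ContMDiffAt 𝓘(ℝ, ℝ) (𝓡 n).tangent ∞ (fun t => (⟨γ t, V t⟩ : TangentBundle (𝓡 n) M)) t₀ ↔
      ContMDiffAt 𝓘(ℝ, ℝ) (𝓡 n) ∞ γ t₀ ∧
        ContDiffAt ℝ ∞ (fun t => tangentCoord x₀ (γ t) (V t)) t₀ := by
  have h' : (⟨γ t₀, V t₀⟩ : TangentBundle (𝓡 n) M) ∈
      (trivializationAt (EuclideanSpace ℝ (Fin n)) (TangentSpace (𝓡 n)) x₀).source := by
    rw [Trivialization.mem_source]; simpa using h
  have key := (trivializationAt (EuclideanSpace ℝ (Fin n)) (TangentSpace (𝓡 n)) x₀).contMDiffAt_iff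
    (IM := 𝓘(ℝ, ℝ)) (IB := 𝓡 n) (n := ∞)
    (f := fun t => (⟨γ t, V t⟩ : TangentBundle (𝓡 n) M)) (x₀ := t₀) h'
  refine key.trans (and_congr_right fun hγ => ?_)
  rw [← contMDiffAt_iff_contDiffAt]
  apply Filter.EventuallyEq.contMDiffAt_iff
  have := hγ.continuousAt.preimage_mem_nhds
    ((chartAt (EuclideanSpace ℝ (Fin n)) x₀).open_source.mem_nhds h)
  filter_upwards [this] with t ht
  exact trivializationAt_snd_eq_tangentCoord ht _

lemma symmL_trivializationAt_eq_mfderiv {x₀ : M} {z : EuclideanSpace ℝ (Fin n)}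
    (hz : z ∈ (extChartAt (𝓡 n) x₀).target) (v : EuclideanSpace ℝ (Fin n)) :
    (trivializationAt (EuclideanSpace ℝ (Fin n)) (TangentSpace (𝓡 n)) x₀).symmL ℝ
      ((extChartAt (𝓡 n) x₀).symm z) v =
    (mfderiv 𝓘(ℝ, EuclideanSpace ℝ (Fin n)) (𝓡 n) (extChartAt (𝓡 n) x₀).symm z v :
      TangentSpace (𝓡 n) ((extChartAt (𝓡 n) x₀).symm z)) := by
  have : IsManifold (𝓡 n) 1 M := IsManifold.of_le (n := ∞) (by simp)
  have hp : (extChartAt (𝓡 n) x₀).symm z ∈ (chartAt (EuclideanSpace ℝ (Fin n)) x₀).source := by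
    rw [← extChartAt_source (𝓡 n)]; exact (extChartAt (𝓡 n) x₀).map_target hz
  rw [TangentBundle.symmL_trivializationAt hp]
  have h2 := (extChartAt (𝓡 n) x₀).right_inv hz
  simp only [ModelWithCorners.range_eq_univ, mfderivWithin_univ]
  rw [h2]
  rfl

variable [RiemannianBundle (fun x : M => TangentSpace (𝓡 n) x)]

lemma metricMatrix_apply {x₀ : M} {z : EuclideanSpace ℝ (Fin n)}
    (hz : z ∈ (extChartAt (𝓡 n) x₀).target) (i j : Fin n) :
    metricMatrix x₀ z i j =
      inner ℝ
        ((trivializationAt (EuclideanSpace ℝ (Fin n)) (TangentSpace (𝓡 n)) x₀).symmL ℝ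
          ((extChartAt (𝓡 n) x₀).symm z) (EuclideanSpace.single i (1 : ℝ)))
        ((trivializationAt (EuclideanSpace ℝ (Fin n)) (TangentSpace (𝓡 n)) x₀).symmL ℝ
          ((extChartAt (𝓡 n) x₀).symm z) (EuclideanSpace.single j (1 : ℝ))) := by
  rw [symmL_trivializationAt_eq_mfderiv hz, symmL_trivializationAt_eq_mfderiv hz]
  rfl

lemma inner_symmL_eq_sum {x₀ : M} {z : EuclideanSpace ℝ (Fin n)}
    (hz : z ∈ (extChartAt (𝓡 n) x₀).target) (v w : EuclideanSpace ℝ (Fin n)) :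
    inner ℝ
        ((trivializationAt (EuclideanSpace ℝ (Fin n)) (TangentSpace (𝓡 n)) x₀).symmL ℝ
          ((extChartAt (𝓡 n) x₀).symm z) v)
        ((trivializationAt (EuclideanSpace ℝ (Fin n)) (TangentSpace (𝓡 n)) x₀).symmL ℝ
          ((extChartAt (𝓡 n) x₀).symm z) w) =
      ∑ i, ∑ j, metricMatrix x₀ z i j * v i * w j := by
  have hs : ∀ v : EuclideanSpace ℝ (Fin n),
      (trivializationAt (EuclideanSpace ℝ (Fin n)) (TangentSpace (𝓡 n)) x₀).symmL ℝ
          ((extChartAt (𝓡 n) x₀).symm z) v = ∑ i, v i •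
        (trivializationAt (EuclideanSpace ℝ (Fin n)) (TangentSpace (𝓡 n)) x₀).symmL ℝ
          ((extChartAt (𝓡 n) x₀).symm z) (EuclideanSpace.single i (1 : ℝ)) := by
    intro v
    conv_lhs => rw [← (EuclideanSpace.basisFun (Fin n) ℝ).sum_repr v, map_sum]
    refine Finset.sum_congr rfl fun i _ => ?_
    rw [EuclideanSpace.basisFun_repr, EuclideanSpace.basisFun_apply]
    exact ContinuousLinearMap.map_smul _ _ _
  rw [hs v, hs w, sum_inner]
  refine Finset.sum_congr rfl fun i _ => ?_
  rw [inner_sum]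
  refine Finset.sum_congr rfl fun j _ => ?_
  rw [inner_smul_left, inner_smul_right, metricMatrix_apply hz]
  simp only [conj_trivial]
  ring

lemma inner_eq_sum_metricMatrix {x₀ p : M}
    (hp : p ∈ (chartAt (EuclideanSpace ℝ (Fin n)) x₀).source) (X Y : TangentSpace (𝓡 n) p) :
    inner ℝ X Y = ∑ i, ∑ j, metricMatrix x₀ (extChartAt (𝓡 n) x₀ p) i j *
      tangentCoord x₀ p X i * tangentCoord x₀ p Y j := by
  obtain ⟨z, hz, rfl⟩ : ∃ z ∈ (extChartAt (𝓡 n) x₀).target, (extChartAt (𝓡 n) x₀).symm z = p := by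
    rw [← extChartAt_source (𝓡 n)] at hp
    exact ⟨_, (extChartAt (𝓡 n) x₀).map_source hp, (extChartAt (𝓡 n) x₀).left_inv hp⟩
  rw [(extChartAt (𝓡 n) x₀).right_inv hz, ← inner_symmL_eq_sum hz,
    ← continuousLinearMapAt_apply_eq_tangentCoord hp,
    ← continuousLinearMapAt_apply_eq_tangentCoord hp,
    Trivialization.symmL_continuousLinearMapAt _ (by simpa using hp),
    Trivialization.symmL_continuousLinearMapAt _ (by simpa using hp)]

/-- A kernel vector `v` of the Gram matrix gives a tangent vector of squared norm `∑ g_ij v_i v_j =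
0`, hence `v = 0`. Thus the matrix inverse in `christoffel` is a true inverse. -/
lemma isUnit_det_metricMatrix {x₀ : M} {z : EuclideanSpace ℝ (Fin n)}
    (hz : z ∈ (extChartAt (𝓡 n) x₀).target) : IsUnit (metricMatrix x₀ z).det := by
  have hp : (extChartAt (𝓡 n) x₀).symm z ∈ (chartAt (EuclideanSpace ℝ (Fin n)) x₀).source := by
    rw [← extChartAt_source (𝓡 n)]; exact (extChartAt (𝓡 n) x₀).map_target hz
  rw [isUnit_iff_ne_zero]
  intro h0
  obtain ⟨v, hv0, hv⟩ := Matrix.exists_mulVec_eq_zero_iff.mpr h0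
  apply hv0
  have h1 := inner_symmL_eq_sum hz (WithLp.toLp 2 v) (WithLp.toLp 2 v)
  have h2 : ∑ i, ∑ j, metricMatrix x₀ z i j * v i * v j = 0 := by
    refine Finset.sum_eq_zero fun i _ => ?_
    have := congrFun hv i
    simp only [Matrix.mulVec, dotProduct, Pi.zero_apply] at this
    calc _ = v i * ∑ j, metricMatrix x₀ z i j * v j := by
          rw [Finset.mul_sum]; exact Finset.sum_congr rfl fun j _ => by ring
      _ = 0 := by rw [this, mul_zero]
  have h3 := inner_self_eq_zero.mp (h1.trans h2)
  have h4 := congrArg ((trivializationAt (EuclideanSpace ℝ (Fin n)) (TangentSpace (𝓡 n))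
    x₀).continuousLinearMapAt ℝ ((extChartAt (𝓡 n) x₀).symm z)) h3
  rw [Trivialization.continuousLinearMapAt_symmL _ (by simpa using hp), map_zero] at h4
  simpa using congrArg WithLp.ofLp h4

/-- The entries are inner products of coordinate fields, which are smooth sections, under a smooth
metric. -/
lemma differentiableAt_metricMatrix [IsContMDiffRiemannianBundle (𝓡 n) ∞ (EuclideanSpace ℝ (Fin n))
      (fun x : M => TangentSpace (𝓡 n) x)] {x₀ : M} {z : EuclideanSpace ℝ (Fin n)}
    (hz : z ∈ (extChartAt (𝓡 n) x₀).target) (i j : Fin n) :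
    DifferentiableAt ℝ (fun z' => metricMatrix x₀ z' i j) z := by
  have hopen := isOpen_extChartAt_target (I := 𝓡 n) x₀
  have hsec : ∀ v : EuclideanSpace ℝ (Fin n),
      ContMDiffAt 𝓘(ℝ, EuclideanSpace ℝ (Fin n)) (𝓡 n).tangent ∞
        (fun z' => (⟨(extChartAt (𝓡 n) x₀).symm z',
          (trivializationAt (EuclideanSpace ℝ (Fin n)) (TangentSpace (𝓡 n)) x₀).symmL ℝ
          ((extChartAt (𝓡 n) x₀).symm z') v⟩ : TangentBundle (𝓡 n) M)) z := by
    intro v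
    have hp : ∀ z' ∈ (extChartAt (𝓡 n) x₀).target, (extChartAt (𝓡 n) x₀).symm z' ∈
        (trivializationAt (EuclideanSpace ℝ (Fin n)) (TangentSpace (𝓡 n) (M := M)) x₀).baseSet := by
      intro z' hz'
      have := (extChartAt (𝓡 n) x₀).map_target hz'
      simpa using this
    rw [Trivialization.contMDiffAt_iff (IB := 𝓡 n)
      (e := trivializationAt (EuclideanSpace ℝ (Fin n)) (TangentSpace (𝓡 n)) x₀)
      (by rw [Trivialization.mem_source]; exact hp z hz)]
    refine ⟨(contMDiffOn_extChartAt_symm x₀).contMDiffAt (hopen.mem_nhds hz), ?_⟩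
    -- Read in the trivialization, the section is constantly `v` near `z`.
    refine (contMDiffAt_const (c := v)).congr_of_eventuallyEq ?_
    filter_upwards [hopen.mem_nhds hz] with z' hz'
    have := Trivialization.continuousLinearMapAt_symmL (R := ℝ) _ (hp z' hz') v
    rwa [Trivialization.continuousLinearMapAt_apply, Trivialization.linearMapAt_apply,
      if_pos (hp z' hz')] at this
  have := ((hsec (EuclideanSpace.single i 1)).inner_bundle
    (hsec (EuclideanSpace.single j 1))).contDiffAt.differentiableAt (by simp)
  refine this.congr_of_eventuallyEq ?_
  filter_upwards [hopen.mem_nhds hz] with z' hz'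
  exact metricMatrix_apply hz' i j

/-- Lowering the upper index cancels the inverse metric and leaves the Christoffel symbols of the
first kind, the only form used below. -/
lemma sum_metricMatrix_mul_christoffel {x₀ : M} {z : EuclideanSpace ℝ (Fin n)}
    (hz : z ∈ (extChartAt (𝓡 n) x₀).target) (m i j : Fin n) :
    ∑ k, metricMatrix x₀ z m k * christoffel x₀ z k i j =
      (1 / 2 : ℝ) * (metricPartial x₀ z i j m + metricPartial x₀ z j i m
        - metricPartial x₀ z m i j) := by
  have h := Matrix.mul_nonsing_inv _ (isUnit_det_metricMatrix hz)
  simp only [christoffel]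
  calc _ = ∑ l, (metricMatrix x₀ z * (metricMatrix x₀ z)⁻¹) m l * ((1 / 2 : ℝ) *
        (metricPartial x₀ z i j l + metricPartial x₀ z j i l - metricPartial x₀ z l i j)) := by
        simp only [Matrix.mul_apply, Finset.mul_sum, Finset.sum_mul]
        rw [Finset.sum_comm]
        exact Finset.sum_congr rfl fun _ _ => Finset.sum_congr rfl fun _ _ => by ring
    _ = _ := by rw [h]; simp [Matrix.one_apply]

end Coordinates

/-! ### Parallel fields have constant inner products -/

section Parallel

lemma sum_mul_eq_of_covariant_eq {n : ℕ} {g : Fin n → Fin n → ℝ} {Γ P : Fin n → Fin n → Fin n → ℝ}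
    (hΓ : ∀ m i j, ∑ k, g m k * Γ k i j = (1 / 2 : ℝ) * (P i j m + P j i m - P m i j))
    {z V V' : Fin n → ℝ} (hV : ∀ k, V' k + ∑ i, ∑ j, Γ k i j * z i * V j = 0) (m : Fin n) :
    ∑ k, g m k * V' k =
      -∑ i, ∑ j, (1 / 2 : ℝ) * (P i j m + P j i m - P m i j) * z i * V j := by
  calc ∑ k, g m k * V' k = -∑ k, ∑ i, ∑ j, g m k * Γ k i j * z i * V j := by
        rw [← Finset.sum_neg_distrib]
        refine Finset.sum_congr rfl fun k _ => ?_
        rw [eq_neg_of_add_eq_zero_left (hV k), mul_neg, Finset.mul_sum]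
        simp only [Finset.mul_sum, mul_assoc]
    _ = _ := by
        rw [Finset.sum_comm]
        congr 1
        refine Finset.sum_congr rfl fun i _ => ?_
        rw [Finset.sum_comm]
        refine Finset.sum_congr rfl fun j _ => ?_
        rw [← hΓ, Finset.sum_mul, Finset.sum_mul]

/-- The algebraic form of the compatibility of the Levi-Civita connection with the metric. -/
lemma sum_metric_compatibility {n : ℕ} {g : Fin n → Fin n → ℝ} {Γ P : Fin n → Fin n → Fin n → ℝ}
    (hg : ∀ i j, g i j = g j i) (hP : ∀ i j l, P i j l = P i l j)
    (hΓ : ∀ m i j, ∑ k, g m k * Γ k i j = (1 / 2 : ℝ) * (P i j m + P j i m - P m i j))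
    {z V V' W W' : Fin n → ℝ} (hV : ∀ k, V' k + ∑ i, ∑ j, Γ k i j * z i * V j = 0)
    (hW : ∀ k, W' k + ∑ i, ∑ j, Γ k i j * z i * W j = 0) :
    ∑ i, ∑ j, (((∑ k, z k * P k i j) * V i + g i j * V' i) * W j + g i j * V i * W' j) = 0 := by
  have h1 : ∑ i, ∑ j, g i j * V' i * W j =
      -∑ k, ∑ i, ∑ j, (1 / 2 : ℝ) * (P k i j + P i k j - P j k i) * z k * V i * W j := by
    rw [Finset.sum_comm]
    calc _ = ∑ j, (∑ i, g j i * V' i) * W j := by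
          refine Finset.sum_congr rfl fun j _ => ?_
          rw [Finset.sum_mul]
          exact Finset.sum_congr rfl fun i _ => by rw [hg i j]
      _ = -∑ j, ∑ k, ∑ i, (1 / 2 : ℝ) * (P k i j + P i k j - P j k i) * z k * V i * W j := by
          simp only [sum_mul_eq_of_covariant_eq hΓ hV, neg_mul, Finset.sum_mul,
            Finset.sum_neg_distrib]
      _ = _ := by
          rw [Finset.sum_comm]
          congr 1
          exact Finset.sum_congr rfl fun k _ => Finset.sum_comm
  have h2 : ∑ i, ∑ j, g i j * V i * W' j =
      -∑ k, ∑ i, ∑ j, (1 / 2 : ℝ) * (P k j i + P j k i - P i k j) * z k * V i * W j := by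
    calc _ = ∑ i, V i * (∑ j, g i j * W' j) := by
          refine Finset.sum_congr rfl fun i _ => ?_
          rw [Finset.mul_sum]
          exact Finset.sum_congr rfl fun j _ => by ring
      _ = -∑ i, ∑ k, ∑ j, (1 / 2 : ℝ) * (P k j i + P j k i - P i k j) * z k * V i * W j := by
          simp only [sum_mul_eq_of_covariant_eq hΓ hW, mul_neg, Finset.mul_sum,
            Finset.sum_neg_distrib]
          congr 1
          exact Finset.sum_congr rfl fun _ _ => Finset.sum_congr rfl fun _ _ =>
            Finset.sum_congr rfl fun _ _ => by ring
      _ = _ := by rw [Finset.sum_comm]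
  have h3 : ∑ i, ∑ j, (∑ k, z k * P k i j) * V i * W j =
      ∑ k, ∑ i, ∑ j, P k i j * z k * V i * W j := by
    simp only [Finset.sum_mul]
    rw [Finset.sum_comm]
    calc _ = ∑ j, ∑ k, ∑ i, P k i j * z k * V i * W j := by
          refine Finset.sum_congr rfl fun j _ => ?_
          rw [Finset.sum_comm]
          exact Finset.sum_congr rfl fun _ _ => Finset.sum_congr rfl fun _ _ => by ring
      _ = _ := by
          rw [Finset.sum_comm]
          exact Finset.sum_congr rfl fun k _ => Finset.sum_comm
  simp only [add_mul, Finset.sum_add_distrib]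
  rw [h1, h2, h3, ← sub_eq_add_neg, ← sub_eq_add_neg, ← Finset.sum_sub_distrib,
    ← Finset.sum_sub_distrib]
  refine Finset.sum_eq_zero fun k _ => ?_
  rw [← Finset.sum_sub_distrib, ← Finset.sum_sub_distrib]
  refine Finset.sum_eq_zero fun i _ => ?_
  rw [← Finset.sum_sub_distrib, ← Finset.sum_sub_distrib]
  refine Finset.sum_eq_zero fun j _ => ?_
  -- In the coefficient of `z k * V i * W j` the mixed terms of the two Christoffel sums cancel,
  -- leaving `½ (P k i j + P k j i) = P k i j`, which cancels the derivative of the metric.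
  rw [hP k j i, hP j k i, hP i k j]
  ring

variable {n : ℕ} {M : Type*} [MetricSpace M] [ChartedSpace (EuclideanSpace ℝ (Fin n)) M]

lemma tangentCoord_smul (x₀ p : M) (c : ℝ) (X : TangentSpace (𝓡 n) p) :
    tangentCoord x₀ p (c • X) = c • tangentCoord x₀ p X :=
  map_smul (mfderiv (𝓡 n) 𝓘(ℝ, EuclideanSpace ℝ (Fin n)) (extChartAt (𝓡 n) x₀) p) c X

variable [IsManifold (𝓡 n) ∞ M] [RiemannianBundle (fun x : M => TangentSpace (𝓡 n) x)]

section Derivative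

variable [IsContMDiffRiemannianBundle (𝓡 n) ∞ (EuclideanSpace ℝ (Fin n))
  (fun x : M => TangentSpace (𝓡 n) x)]

lemma hasDerivAt_metricMatrix_comp {x₀ : M} {c : ℝ → EuclideanSpace ℝ (Fin n)}
    {c' : EuclideanSpace ℝ (Fin n)} {t : ℝ} (hc : HasDerivAt c c' t)
    (ht : c t ∈ (extChartAt (𝓡 n) x₀).target) (i j : Fin n) :
    HasDerivAt (fun s => metricMatrix x₀ (c s) i j)
      (∑ k, c' k * metricPartial x₀ (c t) k i j) t := by
  have h := (differentiableAt_metricMatrix ht i j).hasFDerivAt.comp_hasDerivAt t hc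
  suffices hs : ∑ k, c' k * metricPartial x₀ (c t) k i j =
      fderiv ℝ (fun z' => metricMatrix x₀ z' i j) (c t) c' by rw [hs]; exact h
  conv_rhs => rw [← (EuclideanSpace.basisFun (Fin n) ℝ).sum_repr c', map_sum]
  refine Finset.sum_congr rfl fun k _ => ?_
  rw [EuclideanSpace.basisFun_repr, EuclideanSpace.basisFun_apply, map_smul]
  rfl

/-- In the chart centred at `γ t`, the product rule for `∑ g_ij V^i W^j` together with the parallel
equations gives exactly the sum in `sum_metric_compatibility`. -/
lemma IsParallelAlong.hasDerivAt_inner {γ : ℝ → M} {V W : (t : ℝ) → TangentSpace (𝓡 n) (γ t)}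
    (hV : IsParallelAlong γ V) (hW : IsParallelAlong γ W) (t : ℝ) :
    HasDerivAt (fun s => (inner ℝ (V s) (W s) : ℝ)) 0 t := by
  have hsrc := mem_chart_source (EuclideanSpace ℝ (Fin n)) (γ t)
  have hsrc' := mem_extChartAt_source (I := 𝓡 n) (γ t)
  obtain ⟨hγ, hV1⟩ := (contMDiffAt_tangentBundle_iff hsrc).mp (hV.1 t)
  obtain ⟨-, hW1⟩ := (contMDiffAt_tangentBundle_iff hsrc).mp (hW.1 t)
  have hc : HasDerivAt (fun s => extChartAt (𝓡 n) (γ t) (γ s))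
      (deriv (fun s => extChartAt (𝓡 n) (γ t) (γ s)) t) t := by
    have h : ContMDiffAt 𝓘(ℝ, ℝ) 𝓘(ℝ, EuclideanSpace ℝ (Fin n)) ∞
        (fun s => extChartAt (𝓡 n) (γ t) (γ s)) t :=
      (contMDiffAt_extChartAt' hsrc).comp t hγ
    exact (h.contDiffAt.differentiableAt (by simp)).hasDerivAt
  have hcoord : ∀ {f : ℝ → EuclideanSpace ℝ (Fin n)} {f' : EuclideanSpace ℝ (Fin n)},
      HasDerivAt f f' t → ∀ i, HasDerivAt (fun s => f s i) (f' i) t := fun hf i =>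
    (EuclideanSpace.proj (𝕜 := ℝ) i).hasFDerivAt.comp_hasDerivAt t hf
  have hV2 := hcoord (hV1.differentiableAt (by simp)).hasDerivAt
  have hW2 := hcoord (hW1.differentiableAt (by simp)).hasDerivAt
  have hsum := HasDerivAt.fun_sum (u := Finset.univ) fun i _ =>
    HasDerivAt.fun_sum (u := Finset.univ) fun j _ =>
      ((hasDerivAt_metricMatrix_comp hc ((extChartAt (𝓡 n) (γ t)).map_source hsrc') i j).fun_mul
        (hV2 i)).fun_mul (hW2 j)
  -- The covariant derivative differentiates component by component; differentiability identifies
  -- this with components of vector derivatives.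
  have hcov : ∀ {X : (t : ℝ) → TangentSpace (𝓡 n) (γ t)}, IsParallelAlong γ X →
      (∀ i, HasDerivAt (fun s => tangentCoord (γ t) (γ s) (X s) i)
        (deriv (fun s => tangentCoord (γ t) (γ s) (X s)) t i) t) → ∀ k,
      deriv (fun s => tangentCoord (γ t) (γ s) (X s)) t k +
        ∑ i, ∑ j, christoffel (γ t) (extChartAt (𝓡 n) (γ t) (γ t)) k i j *
          deriv (fun s => extChartAt (𝓡 n) (γ t) (γ s)) t i * tangentCoord (γ t) (γ t) (X t) j
        = 0 := by
    intro X hX hX2 k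
    have := hX.2 t (γ t) hsrc' k
    rw [covDerivCoord, (hX2 k).deriv] at this
    simpa only [(hcoord hc _).deriv] using this
  rw [sum_metric_compatibility (metricMatrix_symm _) (metricPartial_symm _ _)
    (sum_metricMatrix_mul_christoffel ((extChartAt (𝓡 n) (γ t)).map_source hsrc'))
    (hcov hV hV2) (hcov hW hW2)] at hsum
  refine hsum.congr_of_eventuallyEq ?_
  filter_upwards [hγ.continuousAt.preimage_mem_nhds
    ((chartAt (EuclideanSpace ℝ (Fin n)) (γ t)).open_source.mem_nhds hsrc)] with s hs
  exact inner_eq_sum_metricMatrix hs _ _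

lemma IsParallelAlong.inner_eq {γ : ℝ → M} {V W : (t : ℝ) → TangentSpace (𝓡 n) (γ t)}
    (hV : IsParallelAlong γ V) (hW : IsParallelAlong γ W) (s t : ℝ) :
    (inner ℝ (V s) (W s) : ℝ) = inner ℝ (V t) (W t) :=
  is_const_of_deriv_eq_zero (fun t => (hV.hasDerivAt_inner hW t).differentiableAt)
    (fun t => (hV.hasDerivAt_inner hW t).deriv) s t

lemma IsParallelAlong.norm_eq {γ : ℝ → M} {V : (t : ℝ) → TangentSpace (𝓡 n) (γ t)}
    (hV : IsParallelAlong γ V) (s t : ℝ) : ‖V s‖ = ‖V t‖ := by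
  have := hV.inner_eq hV s t
  rw [real_inner_self_eq_norm_sq, real_inner_self_eq_norm_sq] at this
  exact (sq_eq_sq₀ (norm_nonneg _) (norm_nonneg _)).mp this

/-- A parallel field along a curve is determined by its value at one time. -/
lemma IsParallelAlong.eq_of_eq {γ : ℝ → M} {V W : (t : ℝ) → TangentSpace (𝓡 n) (γ t)}
    (hV : IsParallelAlong γ V) (hW : IsParallelAlong γ W) {s : ℝ} (h : V s = W s) (t : ℝ) :
    V t = W t := by
  have h1 := hV.inner_eq hV s t
  have h2 := hV.inner_eq hW s t
  have h3 := hW.inner_eq hW s t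
  -- `‖V - W‖²` expands into three inner products, each constant in time, and it vanishes at `s`.
  rw [← sub_eq_zero, ← inner_self_eq_zero (𝕜 := ℝ), real_inner_sub_sub_self, ← h1, ← h2, ← h3, h]
  ring

end Derivative

lemma IsParallelAlong.const_smul {γ : ℝ → M} {V : (t : ℝ) → TangentSpace (𝓡 n) (γ t)}
    (hV : IsParallelAlong γ V) (c : ℝ) : IsParallelAlong γ (fun t => c • V t) := by
  refine ⟨fun t => ?_, fun t x₀ hx k => ?_⟩
  · have hsrc := mem_chart_source (EuclideanSpace ℝ (Fin n)) (γ t)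
    obtain ⟨hγ, hV1⟩ := (contMDiffAt_tangentBundle_iff hsrc).mp (hV.1 t)
    refine (contMDiffAt_tangentBundle_iff hsrc).mpr ⟨hγ, ?_⟩
    simp only [tangentCoord_smul]
    exact (contDiffAt_const (c := c)).smul hV1
  · have h := congrArg (c * ·) (hV.2 t x₀ hx k)
    simp only [covDerivCoord, tangentCoord_smul, PiLp.smul_apply, smul_eq_mul, mul_zero,
      deriv_const_mul_field] at h ⊢
    rw [← h, mul_add, Finset.mul_sum]
    congr 1
    refine Finset.sum_congr rfl fun i _ => ?_
    rw [Finset.mul_sum]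
    exact Finset.sum_congr rfl fun j _ => by ring

/-- Both terms of `D_t V` contain exactly one time derivative, so reversing time only changes the
overall sign. -/
lemma IsParallelAlong.reverse {γ : ℝ → M} {V : (t : ℝ) → TangentSpace (𝓡 n) (γ t)}
    (hV : IsParallelAlong γ V) :
    IsParallelAlong (fun t => γ (1 - t)) (fun t => V (1 - t)) := by
  refine ⟨hV.1.comp ((contDiff_const.sub contDiff_id).contMDiff), fun t x₀ hx k => ?_⟩
  have hd : ∀ f : ℝ → ℝ, deriv (fun s => f (1 - s)) t = -deriv f (1 - t) := fun f =>
    deriv_comp_const_sub f 1 t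
  have h := hV.2 (1 - t) x₀ hx k
  simp only [covDerivCoord] at h ⊢
  rw [hd (fun s => tangentCoord x₀ (γ s) (V s) k), ← neg_eq_zero, ← h, neg_add, neg_neg,
    ← Finset.sum_neg_distrib]
  congr 1
  refine Finset.sum_congr rfl fun i _ => ?_
  rw [hd (fun s => extChartAt (𝓡 n) x₀ (γ s) i), ← Finset.sum_neg_distrib]
  exact Finset.sum_congr rfl fun j _ => by ring

end Parallel

/-! ### Reversal of geodesics and constant geodesics -/

section Geodesics

variable {n : ℕ} {M : Type*} [MetricSpace M] [ChartedSpace (EuclideanSpace ℝ (Fin n)) M]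

lemma velocity_reverse {γ : ℝ → M} (hγ : ContMDiff 𝓘(ℝ, ℝ) (𝓡 n) ∞ γ) (t : ℝ) :
    velocity (n := n) (fun s => γ (1 - s)) t = (-1 : ℝ) • velocity (n := n) γ (1 - t) := by
  have h1 : HasMFDerivAt 𝓘(ℝ, ℝ) 𝓘(ℝ, ℝ) (fun s : ℝ => 1 - s) t
      (-ContinuousLinearMap.id ℝ ℝ) :=
    ((hasFDerivAt_id t).const_sub 1).hasMFDerivAt
  have h2 := ((hγ.mdifferentiableAt (by simp)).hasMFDerivAt (x := 1 - t)).comp t h1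
  have h3 := h2.mfderiv
  have h4 := congrArg (fun L => L (1 : ℝ)) h3
  have h5 := (mfderiv 𝓘(ℝ, ℝ) (𝓡 n) γ (1 - t)).map_neg (1 : ℝ)
  rw [neg_one_smul]
  exact h4.trans h5

lemma velocity_const (x : M) (t : ℝ) : velocity (n := n) (fun _ => x) t = 0 := by
  simp only [velocity, mfderiv_const]
  rfl

variable [IsManifold (𝓡 n) ∞ M] [RiemannianBundle (fun x : M => TangentSpace (𝓡 n) x)]

lemma IsGeodesic.const (x : M) : IsGeodesic n (fun _ : ℝ => x) := by
  have h0 : velocity (n := n) (fun _ : ℝ => x) = fun _ => 0 := funext (velocity_const x)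
  have h1 : ∀ x₀ : M, tangentCoord x₀ x (0 : TangentSpace (𝓡 n) x) = 0 := fun x₀ =>
    map_zero (mfderiv (𝓡 n) 𝓘(ℝ, EuclideanSpace ℝ (Fin n)) (extChartAt (𝓡 n) x₀) x)
  refine ⟨contMDiff_const, ?_, fun t x₀ _ k => ?_⟩
  · rw [h0]; exact contMDiff_const
  · rw [h0]
    simp [covDerivCoord, h1]

lemma IsGeodesic.reverse {γ : ℝ → M} (hγ : IsGeodesic n γ) :
    IsGeodesic n (fun t => γ (1 - t)) := by
  refine ⟨hγ.1.comp ((contDiff_const.sub contDiff_id).contMDiff), ?_⟩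
  have := hγ.2.reverse.const_smul (-1)
  rwa [show velocity (n := n) (fun s => γ (1 - s)) = fun t => (-1 : ℝ) • velocity (n := n) γ (1 - t)
    from funext (velocity_reverse hγ.1)]

/-- The norm condition `‖v‖ = dist x x = 0` excludes nontrivial geodesic loops; the constant
geodesic realizes `v = 0`. -/
lemma isMinimizingVelocity_self_iff (x : M) (v : TangentSpace (𝓡 n) x) :
    IsMinimizingVelocity x x v ↔ v = 0 := by
  refine ⟨fun h => by simpa using h.2, ?_⟩
  rintro rfl
  refine ⟨⟨fun _ => x, .const x, ?_, rfl⟩, by simp⟩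
  rw [velocity_const]

lemma logExists_self (x : M) : LogExists n x x :=
  ⟨0, (isMinimizingVelocity_self_iff x 0).mpr rfl,
    fun v hv => (isMinimizingVelocity_self_iff x v).mp hv⟩

lemma LogExists.isMinimizingVelocity {x y : M} (h : LogExists n x y) :
    IsMinimizingVelocity x y (riemannianLog n x y) :=
  Classical.epsilon_spec h.exists

lemma riemannianLog_self (x : M) : riemannianLog n x x = 0 :=
  (isMinimizingVelocity_self_iff x _).mp (logExists_self x).isMinimizingVelocity

lemma LogExists.riemannianLog_eq_zero_iff {x y : M} (h : LogExists n x y) :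
    riemannianLog n x y = 0 ↔ x = y := by
  refine ⟨fun h0 => ?_, ?_⟩
  · have := h.isMinimizingVelocity.2
    rw [h0, norm_zero] at this
    exact dist_eq_zero.mp this.symm
  · rintro rfl
    exact riemannianLog_self x

variable [IsContMDiffRiemannianBundle (𝓡 n) ∞ (EuclideanSpace ℝ (Fin n))
  (fun x : M => TangentSpace (𝓡 n) x)]

/-- The reverse of a minimizing geodesic segment is minimizing. -/
lemma IsGeodesicSegment.isMinimizingVelocity_reverse {γ : ℝ → M} {x y : M}
    {v : TangentSpace (𝓡 n) x} (hγ : IsGeodesicSegment γ x v y) (hv : ‖v‖ = dist x y)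
    {w : TangentSpace (𝓡 n) y}
    (hw : (⟨γ 1, velocity γ 1⟩ : TangentBundle (𝓡 n) M) = ⟨y, w⟩) :
    IsMinimizingVelocity y x (-w) := by
  obtain ⟨hg, h0, rfl⟩ := hγ
  obtain rfl := TotalSpace.mk_inj.mp hw
  have hx : γ 0 = x := congrArg TotalSpace.proj h0
  subst hx
  obtain rfl := TotalSpace.mk_inj.mp h0
  refine ⟨⟨fun t => γ (1 - t), hg.reverse, ?_, by simp⟩, ?_⟩
  · rw [velocity_reverse hg.1, neg_one_smul]
    exact congrArg (fun s => (⟨γ s, -velocity γ s⟩ : TangentBundle (𝓡 n) M)) (sub_zero (1 : ℝ))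
  -- Constant speed: the velocity field is parallel, so its norms at times `1` and `0` agree.
  · rw [norm_neg, hg.2.norm_eq 1 0, hv, dist_comm]

lemma IsMinimizingVelocity.exists_reverse {x y : M} {v : TangentSpace (𝓡 n) x}
    (h : IsMinimizingVelocity x y v) : ∃ w, IsMinimizingVelocity (n := n) y x w := by
  obtain ⟨⟨γ, hγ⟩, hv⟩ := h
  obtain rfl := hγ.2.2
  exact ⟨_, hγ.isMinimizingVelocity_reverse hv rfl⟩

/-- The field `V` shows that the defining choice is satisfiable; uniqueness of parallel fields then
fixes the chosen endpoint value. -/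
lemma parallelTransport_eq {x y : M} {X : TangentSpace (𝓡 n) x} {Y : TangentSpace (𝓡 n) y}
    {V : (t : ℝ) → TangentSpace (𝓡 n) (minGeodesic n x y t)}
    (hV : IsParallelAlong (minGeodesic n x y) V)
    (h0 : (⟨minGeodesic n x y 0, V 0⟩ : TangentBundle (𝓡 n) M) = ⟨x, X⟩)
    (h1 : (⟨minGeodesic n x y 1, V 1⟩ : TangentBundle (𝓡 n) M) = ⟨y, Y⟩) :
    parallelTransport x y X = Y := by
  obtain ⟨W, hW, hW0, hW1⟩ : ∃ W : (t : ℝ) → TangentSpace (𝓡 n) (minGeodesic n x y t),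
      IsParallelAlong (minGeodesic n x y) W ∧
      (⟨minGeodesic n x y 0, W 0⟩ : TangentBundle (𝓡 n) M) = ⟨x, X⟩ ∧
      (⟨minGeodesic n x y 1, W 1⟩ : TangentBundle (𝓡 n) M) = ⟨y, parallelTransport x y X⟩ :=
    Classical.epsilon_spec
      (p := fun Y => ∃ W : (t : ℝ) → TangentSpace (𝓡 n) (minGeodesic n x y t),
        IsParallelAlong (minGeodesic n x y) W ∧
        (⟨minGeodesic n x y 0, W 0⟩ : TangentBundle (𝓡 n) M) = ⟨x, X⟩ ∧
        (⟨minGeodesic n x y 1, W 1⟩ : TangentBundle (𝓡 n) M) = ⟨y, Y⟩) ⟨Y, V, hV, h0, h1⟩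
  have h : W 1 = V 1 := hW.eq_of_eq hV (TotalSpace.mk_inj.mp (hW0.trans h0.symm)) 1
  rw [h] at hW1
  exact TotalSpace.mk_inj.mp (hW1.symm.trans h1)

/-- Parallel transport along `γ_yx` carries `log_y x` to `-log_x y`. -/
lemma LogExists.parallelTransport_smul_riemannianLog {x y : M} (h : LogExists n x y) (c : ℝ) :
    parallelTransport y x (c • riemannianLog n y x) = -(c • riemannianLog n x y) := by
  -- Existence alone suffices here: whichever minimizing velocity at `y` is chosen, its reversal
  -- must be the unique one at `x`.
  have hmin : IsMinimizingVelocity y x (riemannianLog n y x) :=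
    Classical.epsilon_spec h.isMinimizingVelocity.exists_reverse
  have hγ : IsGeodesicSegment (minGeodesic n y x) y (riemannianLog n y x) x :=
    @Classical.epsilon_spec_aux (ℝ → M) ⟨fun _ => y⟩ _ hmin.1
  -- The final velocity lies over `minGeodesic n y x 1`, which equals `x` only propositionally; `w`
  -- is that vector seen in the tangent space at `x`.
  obtain ⟨w, hw⟩ : ∃ w : TangentSpace (𝓡 n) x, (⟨minGeodesic n y x 1,
      velocity (minGeodesic n y x) 1⟩ : TangentBundle (𝓡 n) M) = ⟨x, w⟩ := by
    have := hγ.2.2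
    generalize velocity (n := n) (minGeodesic n y x) 1 = u
    generalize minGeodesic n y x 1 = p at *
    subst this
    exact ⟨u, rfl⟩
  have hlog : -w = riemannianLog n x y :=
    h.unique (hγ.isMinimizingVelocity_reverse hmin.2 hw) h.isMinimizingVelocity
  have hsmul : ∀ {p q : M} {a : TangentSpace (𝓡 n) p} {b : TangentSpace (𝓡 n) q},
      (⟨p, a⟩ : TangentBundle (𝓡 n) M) = ⟨q, b⟩ →
      (⟨p, c • a⟩ : TangentBundle (𝓡 n) M) = ⟨q, c • b⟩ := by
    intro p q a b hab
    obtain rfl : p = q := congrArg TotalSpace.proj hab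
    rw [TotalSpace.mk_inj.mp hab]
  rw [← hlog, smul_neg, neg_neg]
  exact parallelTransport_eq (hγ.1.2.const_smul c) (hsmul hγ.2.1) (hsmul hw)

end Geodesics

/-! ### Fréchet means -/

section FrechetMeans

variable {N : ℕ} {M : Type*} [MetricSpace M]

/-- The objective is `0` at `p`, so at any minimizer each squared distance vanishes. -/
lemma frechetMean_eq_of_forall_eq [Nonempty M] {f : Fin N → M} {s : Finset (Fin N)}
    (hs : s.Nonempty) {p : M} (h : ∀ u ∈ s, f u = p) : frechetMean f s = p := by
  have hp : ∑ u ∈ s, dist p (f u) ^ 2 = 0 := Finset.sum_eq_zero fun u hu => by simp [h u hu]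
  have hmean : IsFrechetMean f s (frechetMean f s) :=
    Classical.epsilon_spec (p := fun m => IsFrechetMean f s m)
      ⟨p, fun x => hp.le.trans (Finset.sum_nonneg fun _ _ => sq_nonneg _)⟩
  have h0 := (Finset.sum_eq_zero_iff_of_nonneg fun _ _ => sq_nonneg _).mp
    (le_antisymm ((hmean p).trans hp.le) (Finset.sum_nonneg fun _ _ => sq_nonneg _))
  obtain ⟨u, hu⟩ := hs
  simpa [h u hu] using h0 u hu

lemma subsingleton_of_existsUnique_isFrechetMean_empty {f : Fin N → M}
    (h : ∃! m, IsFrechetMean f ∅ m) : Subsingleton M :=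
  ⟨fun a b => h.unique (fun x => by simp) (fun x => by simp)⟩

/-- If one set is empty then `h` is vacuous, but every point minimizes the empty sum, so uniqueness
of the mean forces `M` to be a single point. -/
lemma frechetMean_eq_frechetMean [Nonempty M] {f : Fin N → M} {s t : Finset (Fin N)}
    (hs : ∃! m, IsFrechetMean f s m) (ht : ∃! m, IsFrechetMean f t m)
    (h : ∀ u ∈ s, ∀ v ∈ t, f u = f v) : frechetMean f s = frechetMean f t := by
  rcases s.eq_empty_or_nonempty with rfl | ⟨u, hu⟩
  · have := subsingleton_of_existsUnique_isFrechetMean_empty hs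
    exact Subsingleton.elim _ _
  rcases t.eq_empty_or_nonempty with rfl | ⟨v, hv⟩
  · have := subsingleton_of_existsUnique_isFrechetMean_empty ht
    exact Subsingleton.elim _ _
  rw [frechetMean_eq_of_forall_eq ⟨u, hu⟩ fun a ha => h a ha v hv,
    frechetMean_eq_of_forall_eq ⟨v, hv⟩ fun b hb => (h u hu b hb).symm.trans (h u hu v hv)]

end FrechetMeans

theorem mainTheorem2 {n N : ℕ} {M : Type*} [MetricSpace M]
    [ChartedSpace (EuclideanSpace ℝ (Fin n)) M] [IsManifold (𝓡 n) ∞ M]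
    [RiemannianBundle (fun x : M => TangentSpace (𝓡 n) x)]
    [IsContMDiffRiemannianBundle (𝓡 n) ∞ (EuclideanSpace ℝ (Fin n))
      (fun x : M => TangentSpace (𝓡 n) x)]
    [IsRiemannianManifold (𝓡 n) M] [ConnectedSpace M] [CompleteSpace M]
    (OH : OrientedHypergraph N) (f : Fin N → M) (hf : IsAdmissible n OH f) :
    -- vanishing of the Fréchet gradient where `f` is locally constant
    (∀ e : OH.edges, (∀ u ∈ e.1.1, ∀ v ∈ e.1.2, f u = f v) →
      LogExists n (frechetMean f e.1.1) (frechetMean f e.1.2) ∧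
      frechetGradient n OH f e = 0) ∧
    -- antisymmetry of the Fréchet gradient
    (OH.HasSymmetricWeights →
      ∀ (e : Finset (Fin N) × Finset (Fin N)) (he : e ∈ OH.edges)
        (he' : oppositeEdge e ∈ OH.edges),
        LogExists n (frechetMean f e.1) (frechetMean f e.2) →
        frechetGradient n OH f ⟨e, he⟩ =
          -parallelTransport (frechetMean f e.2) (frechetMean f e.1)
            (frechetGradient n OH f ⟨oppositeEdge e, he'⟩)) ∧
    -- kernel of the pairwise gradient
    (∀ e : OH.edges,
      ((∀ u ∈ e.1.1, ∀ v ∈ e.1.2, f u = f v) → pairwiseGradient n OH f e = 0) ∧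
      (0 < OH.weight e →
        (pairwiseGradient n OH f e = 0 ↔ ∀ u ∈ e.1.1, ∀ v ∈ e.1.2, f u = f v))) ∧
    -- antisymmetry of the components of the pairwise gradient
    (OH.HasSymmetricWeights →
      ∀ (e : Finset (Fin N) × Finset (Fin N)) (he : e ∈ OH.edges)
        (he' : oppositeEdge e ∈ OH.edges),
        ∀ u ∈ e.1, ∀ v ∈ e.2,
          pairwiseGradient n OH f ⟨e, he⟩ u v =
            -parallelTransport (f v) (f u)
              (pairwiseGradient n OH f ⟨oppositeEdge e, he'⟩ v u)) := by
  have hzero : ∀ e : OH.edges, (∀ u ∈ e.1.1, ∀ v ∈ e.1.2, f u = f v) →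
      pairwiseGradient n OH f e = 0 := fun e h => by
    funext u v
    rw [pairwiseGradient]
    split_ifs with huv
    · rw [((hf e.1 e.2).2.2 u huv.1 v huv.2).riemannianLog_eq_zero_iff.mpr (h u huv.1 v huv.2),
        smul_zero]
      rfl
    · rfl
  refine ⟨fun e he => ?_, fun hw e he he' hlog => ?_, fun e => ⟨hzero e, fun hw => ⟨fun h => ?_,
    hzero e⟩⟩, fun hw e he he' u hu v hv => ?_⟩
  · obtain ⟨h1, h2, -⟩ := hf e.1 e.2
    have heq := frechetMean_eq_frechetMean h1 h2 he
    have hlog : LogExists n (frechetMean f e.1.1) (frechetMean f e.1.2) := heq ▸ logExists_self _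
    refine ⟨hlog, ?_⟩
    rw [frechetGradient, hlog.riemannianLog_eq_zero_iff.mpr heq, smul_zero]
  · simp only [frechetGradient, hw e he he']
    exact (neg_eq_iff_eq_neg.mpr (hlog.parallelTransport_smul_riemannianLog _)).symm
  · intro u hu v hv
    have h0 : pairwiseGradient n OH f e u v = 0 := congrFun (congrFun h u) v
    rw [pairwiseGradient, if_pos ⟨hu, hv⟩, smul_eq_zero_iff_right] at h0
    · exact ((hf e.1 e.2).2.2 u hu v hv).riemannianLog_eq_zero_iff.mp h0
    -- The members `u` and `v` make both cardinalities positive, so with `w(e) > 0` the scalar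
    -- factor is nonzero.
    · have hin : (0 : ℝ) < e.1.1.card := Nat.cast_pos.mpr (Finset.card_pos.mpr ⟨u, hu⟩)
      have hout : (0 : ℝ) < e.1.2.card := Nat.cast_pos.mpr (Finset.card_pos.mpr ⟨v, hv⟩)
      have := Real.sqrt_pos.mpr (NNReal.coe_pos.mpr hw)
      positivity
  · rw [pairwiseGradient, pairwiseGradient, if_pos ⟨hu, hv⟩, if_pos ⟨hv, hu⟩, hw e he he',
      ((hf e he).2.2 u hu v hv).parallelTransport_smul_riemannianLog, neg_neg]
    -- What remains is that the product of the two cardinalities is unchanged when the edge is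
    -- reversed.
    simp only [oppositeEdge, mul_comm]
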